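/- Let $p\neq 2$ be a prime, let $v=v_p$ be the $p$-adic valuation on $\mathbb{Z}_p$ (with $v(0)=\infty$), and identify the monic quartic $x^4+c_2x^2+c_1x+c_0\in\mathbb{Z}_p[x]$ without cubic term with the point $(c_0,c_1,c_2)\in\mathbb{Z}_p^3$, where $\mathbb{Z}_p^3$ carries its normalized Haar measure $\mu$. Let $$S=\{(c_0,c_1,c_2)\in\mathbb{Z}_p^3 : v(c_0)=2,\ v(c_1)\ge 2,\ v(c_2)\ge 1\}.$$ The Newton polygon of $f\in\mathbb{Z}_p[x]$ is the lower boundary of the convex hull of the points $(i,j)$ such that the coefficient of $x^i$ in $f$ has finite valuation $j$. Then $S$ consists exactly of those $(c_0,c_1,c_2)$ for which the Newton polygon of $x^4+c_2x^2+c_1x+c_0$ is the single segment from $(0,2)$ to $(4,0)$ (of slope $-1/2$). Moreover $S$ and the set $S^{\mathrm{irr}}$ of those points of $S$ whose quartic is irreducible in $\mathbb{Z}_p[x]$ are measurable, $\mu(S)>0$, and the proportion of $S$ that is irreducible is $$\frac{\mu(S^{\mathrm{irr}})}{\mu(S)}=\frac{p^2+3p+1}{2p(p+1)}=\frac{p+2}{2(p+1)}+\frac{1}{2p}.$$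 -/

import Mathlib

open Polynomial MeasureTheory

namespace PadicQuartic

section

variable (p : ℕ) [Fact p.Prime]

/-- `ℤ_p` carries its Borel σ-algebra. -/
noncomputable instance instMeasurableSpacePadicInt : MeasurableSpace ℤ_[p] := borel ℤ_[p]

instance instBorelSpacePadicInt : BorelSpace ℤ_[p] := ⟨rfl⟩

/-- The Haar measure on `ℤ_p`, normalised so that `ℤ_p` has measure `1`. -/
noncomputable def haarZp : Measure ℤ_[p] := Measure.addHaarMeasure ⊤

instance instIsAddHaarMeasureHaarZp : (haarZp p).IsAddHaarMeasure := by
  unfold haarZp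
  infer_instance

instance instIsProbabilityMeasureHaarZp : IsProbabilityMeasure (haarZp p) :=
  ⟨by simpa [haarZp] using
    Measure.addHaarMeasure_self (K₀ := (⊤ : TopologicalSpace.PositiveCompacts ℤ_[p]))⟩

/-- The (normalised) Haar measure on `ℤ_p ^ 3`, the space of coefficients `(c₀, c₁, c₂)` of
the monic quartics with no cubic term. -/
noncomputable def haarZp3 : Measure (Fin 3 → ℤ_[p]) := Measure.pi fun _ => haarZp p

instance instIsProbabilityMeasureHaarZp3 : IsProbabilityMeasure (haarZp3 p) := by
  unfold haarZp3
  infer_instance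

end

section

variable {p : ℕ} [Fact p.Prime]

/-- The `p`-adic valuation on `ℤ_p`, with `v(0) = ∞`. -/
noncomputable def vp (a : ℤ_[p]) : ℕ∞ := emultiplicity (p : ℤ_[p]) a

/-- The monic quartic `x⁴ + c₂ x² + c₁ x + c₀`. -/
noncomputable def quartic (c : Fin 3 → ℤ_[p]) : ℤ_[p][X] :=
  X ^ 4 + C (c 2) * X ^ 2 + C (c 1) * X + C (c 0)

/-- The points `(i, j)` of the plane such that the coefficient of `x ^ i` in `f` has (finite)
valuation `j`; zero coefficients give no point. -/
def newtonPoints (f : ℤ_[p][X]) : Set (ℝ × ℝ) :=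
  {P | ∃ i j : ℕ, vp (f.coeff i) = (j : ℕ∞) ∧ P = ((i : ℝ), (j : ℝ))}

/-- The Newton polygon of `f`: the lower boundary of the convex hull of `newtonPoints f`. -/
def newtonPolygon (f : ℤ_[p][X]) : Set (ℝ × ℝ) :=
  {P | P ∈ convexHull ℝ (newtonPoints f) ∧
    ∀ y : ℝ, y < P.2 → (P.1, y) ∉ convexHull ℝ (newtonPoints f)}

variable (p)

/-- The coefficient vectors with `v(c₀) = 2`, `v(c₁) ≥ 2` and `v(c₂) ≥ 1`. -/
def slopeHalf : Set (Fin 3 → ℤ_[p]) := {c | vp (c 0) = 2 ∧ 2 ≤ vp (c 1) ∧ 1 ≤ vp (c 2)}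

/-- The coefficient vectors of the quartics that are irreducible in `ℤ_p[x]`. -/
def irreducibleQuartics : Set (Fin 3 → ℤ_[p]) := {c | Irreducible (quartic c)}

/-- The proportion of the elements of `S` that lie in `A`, with respect to the Haar measure. -/
noncomputable def proportion (A S : Set (Fin 3 → ℤ_[p])) : ℝ :=
  (haarZp3 p).real (S ∩ A) / (haarZp3 p).real S

end

end PadicQuartic

/-!
Write `c = (p² d, p² b, p a)`; the set in question is the image, under this scaling, of the points
`(d, b, a)` with `d` a unit. Scaling multiplies Haar measure by a constant
(`exists_haarZp3_image_scale`), so the proportion may be computed in the coordinates `(d, b, a)`.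

Such a quartic has no root, and its only possible factorisations are
`(x² + p σ x + p τ) (x² - p σ x + p τ')`. Putting `ε = τ' - τ` and `Δ = a² - 4 d`, the quartic is
reducible if and only if
`σ ε = b` and `ε² = Δ + 2 p a σ² + p² σ⁴` for some `σ, ε ∈ ℤ_p`
(`irreducible_quartic_scale_iff`, `mem_splitSet_iff_disc`). If `Δ ≠ 0` has valuation `m`, then
`v(ε²)` and `v(2 p a σ²)` have different parity, so exactly one of these terms accounts for the
leading term of `Δ`. With Hensel's lemma in the other direction, solvability becomes: `p ^ m ∣ b`,
and the leading coefficient `Δ / p ^ m` (for even `m`), respectively `-2 a Δ / p ^ m` (for odd `m`),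
is a square modulo `p` (`splitLevel_subset_splitSet`, `mem_splitLevel_of_mem_splitSet`).

For fixed `a` the map `d ↦ a² - 4 d` preserves Haar measure, so slicing along `d` gives the measure
of each level: `p⁻ᵐ (p - 1) / (2 p) · p⁻ᵐ · (p - 1) / p` for `m ≥ 1`
(`haarZp3_splitLevel_succ`), and `(p - 1) / (2 p) - (p - 1) / p²` for `m = 0`
(`haarZp3_splitLevel_zero_add`). The locus `Δ = 0` is null, and the sum over `m` is geometric.
Measurability holds because the reducible locus is a continuous image of the compact space `ℤ_p³`.
-/

namespace PadicQuartic

open scoped ENNReal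

variable {p : ℕ} [Fact p.Prime]

/-! ### Scaled coordinates -/

/-- The map `(d, b, a) ↦ (p² d, p² b, p a)`, by which the coefficient vectors `(c₀, c₁, c₂)` with
`v(c₀) = 2`, `v(c₁) ≥ 2`, `v(c₂) ≥ 1` are parametrised. -/
noncomputable def scale (y : Fin 3 → ℤ_[p]) : Fin 3 → ℤ_[p] :=
  ![(p : ℤ_[p]) ^ 2 * y 0, (p : ℤ_[p]) ^ 2 * y 1, (p : ℤ_[p]) * y 2]

lemma isUnit_iff_not_dvd {x : ℤ_[p]} : IsUnit x ↔ ¬ (p : ℤ_[p]) ∣ x := by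
  rw [← PadicInt.norm_lt_one_iff_dvd, ← PadicInt.not_isUnit_iff, not_not]

lemma natCast_prime_ne_zero : (p : ℤ_[p]) ≠ 0 := PadicInt.prime_p.ne_zero

lemma le_vp_iff {n : ℕ} {x : ℤ_[p]} : (n : ℕ∞) ≤ vp x ↔ (p : ℤ_[p]) ^ n ∣ x :=
  pow_dvd_iff_le_emultiplicity.symm

lemma vp_eq_iff {n : ℕ} {x : ℤ_[p]} :
    vp x = n ↔ (p : ℤ_[p]) ^ n ∣ x ∧ ¬ (p : ℤ_[p]) ^ (n + 1) ∣ x :=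
  emultiplicity_eq_coe

lemma scale_mem_slopeHalf_iff {y : Fin 3 → ℤ_[p]} : scale y ∈ slopeHalf p ↔ IsUnit (y 0) := by
  have h2 : (2 : ℕ∞) = ((2 : ℕ) : ℕ∞) := rfl
  have h1 : (1 : ℕ∞) = ((1 : ℕ) : ℕ∞) := rfl
  simp only [slopeHalf, Set.mem_ofPred_eq, h2, h1, le_vp_iff, vp_eq_iff, scale]
  have hp := natCast_prime_ne_zero (p := p)
  simp [isUnit_iff_not_dvd, pow_succ _ 2, mul_dvd_mul_iff_left, hp]

lemma slopeHalf_subset_range_scale : slopeHalf p ⊆ Set.range (scale (p := p)) := by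
  have h2 : (2 : ℕ∞) = ((2 : ℕ) : ℕ∞) := rfl
  have h1 : (1 : ℕ∞) = ((1 : ℕ) : ℕ∞) := rfl
  rintro c ⟨h0, h01, h02⟩
  rw [h2, vp_eq_iff] at h0
  rw [h2, le_vp_iff] at h01
  rw [h1, le_vp_iff, pow_one] at h02
  obtain ⟨d, hd⟩ := h0.1
  obtain ⟨b, hb⟩ := h01
  obtain ⟨a, ha⟩ := h02
  refine ⟨![d, b, a], ?_⟩
  ext i
  fin_cases i <;> simp [scale, hd, hb, ha]

lemma slopeHalf_eq_image : slopeHalf p = scale '' {y | IsUnit (y 0)} := by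
  ext c
  constructor
  · intro hc
    obtain ⟨y, rfl⟩ := slopeHalf_subset_range_scale hc
    exact ⟨y, scale_mem_slopeHalf_iff.1 hc, rfl⟩
  · rintro ⟨y, hy, rfl⟩
    exact scale_mem_slopeHalf_iff.2 hy

/-! ### Factorisations of the quartic -/

lemma quartic_monic (c : Fin 3 → ℤ_[p]) : (quartic c).Monic := by
  unfold quartic; monicity!

lemma quartic_natDegree (c : Fin 3 → ℤ_[p]) : (quartic c).natDegree = 4 := by
  unfold quartic; compute_degree!

lemma coeff_quartic (c : Fin 3 → ℤ_[p]) (i : ℕ) :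
    (quartic c).coeff i = if i = 0 then c 0 else if i = 1 then c 1 else if i = 2 then c 2
      else if i = 4 then 1 else 0 := by
  rcases i with _ | _ | _ | _ | _ | i <;>
    simp [quartic, coeff_X, coeff_C, coeff_X_pow]

lemma monic_quadratic_eq {R : Type*} [CommRing R] {g : R[X]} (hg : g.Monic)
    (h : g.natDegree = 2) : g = X ^ 2 + C (g.coeff 1) * X + C (g.coeff 0) := by
  conv_lhs => rw [hg.as_sum, h]
  simp [Finset.sum_range_succ]
  ring

/-- A quartic without cubic term factors into two monic quadratics exactly when they have
opposite linear coefficients and the remaining coefficients match. -/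
lemma quadratic_mul_eq_quartic_iff (c : Fin 3 → ℤ_[p]) (s t s' t' : ℤ_[p]) :
    (X ^ 2 + C s * X + C t) * (X ^ 2 + C s' * X + C t') = quartic c ↔
      s' = -s ∧ t + t' - s ^ 2 = c 2 ∧ s * (t' - t) = c 1 ∧ t * t' = c 0 := by
  have key : (X ^ 2 + C s * X + C t) * (X ^ 2 + C s' * X + C t') =
      X ^ 4 + C (s + s') * X ^ 3 + C (t + t' + s * s') * X ^ 2 + C (s * t' + s' * t) * X
        + C (t * t') := by
    simp only [map_add, map_mul]; ring
  rw [key]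
  constructor
  · intro h
    have e3 := congrArg (fun f => coeff f 3) h
    have e2 := congrArg (fun f => coeff f 2) h
    have e1 := congrArg (fun f => coeff f 1) h
    have e0 := congrArg (fun f => coeff f 0) h
    simp [-map_add, -map_mul, -map_neg, coeff_quartic, coeff_X, coeff_C, coeff_X_pow] at e3 e2 e1 e0
    have hs : s' = -s := by linear_combination e3
    subst hs
    exact ⟨rfl, by linear_combination e2, by linear_combination e1, e0⟩
  · rintro ⟨rfl, h2, h1, h0⟩
    rw [quartic, ← h2, ← h1, ← h0]
    simp only [map_add, map_mul, map_sub, map_neg, map_pow]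
    ring

lemma quartic_scale_no_root {y : Fin 3 → ℤ_[p]} (hy : IsUnit (y 0)) (x : ℤ_[p]) :
    (quartic (scale y)).eval x ≠ 0 := by
  intro h
  simp [quartic, scale] at h
  have hx : (p : ℤ_[p]) ∣ x := by
    refine PadicInt.prime_p.dvd_of_dvd_pow (n := 4) ?_
    exact ⟨-(y 2 * x ^ 2 + p * y 1 * x + p * y 0), by linear_combination h⟩
  obtain ⟨z, rfl⟩ := hx
  refine isUnit_iff_not_dvd.1 hy ⟨-(p * z ^ 4 + y 2 * z ^ 2 + y 1 * z), ?_⟩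
  refine mul_left_cancel₀ (pow_ne_zero 2 (natCast_prime_ne_zero (p := p))) ?_
  linear_combination h

/-- The coefficients of a factorisation into two quadratics of a quartic with Newton polygon of
slope `-1/2` are divisible by `p`. -/
lemma dvd_of_quadratic_factors {y : Fin 3 → ℤ_[p]} {s t t' : ℤ_[p]}
    (h2 : t + t' - s ^ 2 = p * y 2) (h1 : s * (t' - t) = p ^ 2 * y 1)
    (h0 : t * t' = p ^ 2 * y 0) : (p : ℤ_[p]) ∣ s ∧ (p : ℤ_[p]) ∣ t ∧ (p : ℤ_[p]) ∣ t' := by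
  have hP := PadicInt.prime_p (p := p)
  have hst : (p : ℤ_[p]) ∣ t ↔ (p : ℤ_[p]) ∣ t' := by
    have aux : ∀ {t t' : ℤ_[p]}, t + t' - s ^ 2 = p * y 2 →
        (p : ℤ_[p]) ∣ s * (t' - t) → (p : ℤ_[p]) ∣ t → (p : ℤ_[p]) ∣ t' := by
      intro t t' h2 h1 ht
      rcases hP.dvd_or_dvd h1 with hs | hs
      · have : t' = p * y 2 + s * s - t := by linear_combination h2
        rw [this]
        exact dvd_sub (dvd_add (dvd_mul_right _ _) (hs.mul_right _)) ht
      · simpa using dvd_add hs ht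
    refine ⟨aux h2 ⟨p * y 1, by rw [h1]; ring⟩, aux (t := t') (t' := t) (by rw [← h2]; ring)
      ⟨-(p * y 1), by linear_combination -h1⟩⟩
  have ht : (p : ℤ_[p]) ∣ t := by
    rcases hP.dvd_or_dvd (⟨p * y 0, by rw [h0]; ring⟩ : (p : ℤ_[p]) ∣ t * t') with h | h
    · exact h
    · exact hst.2 h
  have ht' := hst.1 ht
  refine ⟨hP.dvd_of_dvd_pow (n := 2) ?_, ht, ht'⟩
  have : s ^ 2 = t + t' - p * y 2 := by linear_combination -h2
  rw [this]
  exact dvd_sub (dvd_add ht ht') (dvd_mul_right _ _)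

/-- The points `(d, b, a)` for which `x⁴ + p a x² + p² b x + p² d` is the product of
`x² + p σ x + p τ` and `x² - p σ x + p τ'` for some `σ`, `τ`, `τ'`. -/
def splitSet (p : ℕ) [Fact p.Prime] : Set (Fin 3 → ℤ_[p]) :=
  Set.range fun v : Fin 3 → ℤ_[p] =>
    ![v 1 * v 2, v 0 * (v 2 - v 1), v 1 + v 2 - p * v 0 ^ 2]

lemma mem_splitSet_iff {y : Fin 3 → ℤ_[p]} :
    y ∈ splitSet p ↔ ∃ σ τ τ' : ℤ_[p], τ * τ' = y 0 ∧ σ * (τ' - τ) = y 1 ∧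
      τ + τ' - p * σ ^ 2 = y 2 := by
  constructor
  · rintro ⟨v, rfl⟩
    exact ⟨v 0, v 1, v 2, by simp⟩
  · rintro ⟨σ, τ, τ', h0, h1, h2⟩
    refine ⟨![σ, τ, τ'], ?_⟩
    ext i
    fin_cases i <;> simp [h0, h1, h2]

lemma irreducible_quartic_scale_iff {y : Fin 3 → ℤ_[p]} (hy : IsUnit (y 0)) :
    Irreducible (quartic (scale y)) ↔ y ∉ splitSet p := by
  have hm := quartic_monic (scale y)
  have hp0 := natCast_prime_ne_zero (p := p)
  rw [hm.irreducible_iff_natDegree', quartic_natDegree]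
  constructor
  · rintro ⟨-, h⟩ hy'
    obtain ⟨σ, τ, τ', h0, h1, h2⟩ := mem_splitSet_iff.1 hy'
    refine h (X ^ 2 + C (p * σ) * X + C (p * τ)) (X ^ 2 + C (-(p * σ)) * X + C (p * τ'))
      (by monicity!) (by monicity!) ?_ ?_
    · rw [quadratic_mul_eq_quartic_iff]
      refine ⟨rfl, ?_, ?_, ?_⟩
      · simp [scale, ← h2]; ring
      · simp [scale, ← h1]; ring
      · simp [scale, ← h0]; ring
    · have : (X ^ 2 + C (-(p * σ)) * X + C (p * τ')).natDegree = 2 := by compute_degree!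
      rw [this]; simp
  · intro hy'
    refine ⟨fun h => by simpa [h] using quartic_natDegree (scale y), fun f g hf hg hfg hd => ?_⟩
    have hdeg : f.natDegree + g.natDegree = 4 := by
      rw [← hf.natDegree_mul hg, hfg, quartic_natDegree]
    have hd' : g.natDegree = 1 ∨ g.natDegree = 2 := by
      simp at hd; omega
    rcases hd' with h1 | h2
    · refine quartic_scale_no_root hy (-g.coeff 0) ?_
      rw [← hfg, eval_mul, hg.eq_X_add_C h1]
      simp
    · have hf2 : f.natDegree = 2 := by omega
      rw [monic_quadratic_eq hf hf2, monic_quadratic_eq hg h2,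
        quadratic_mul_eq_quartic_iff] at hfg
      obtain ⟨-, e2, e1, e0⟩ := hfg
      simp only [scale, Matrix.cons_val] at e2 e1 e0
      obtain ⟨⟨σ, hσ⟩, ⟨τ, hτ⟩, ⟨τ', hτ'⟩⟩ := dvd_of_quadratic_factors e2 e1 e0
      rw [hσ, hτ, hτ'] at e2
      rw [hσ, hτ, hτ'] at e1
      rw [hτ, hτ'] at e0
      refine hy' (mem_splitSet_iff.2 ⟨σ, τ, τ', ?_, ?_, ?_⟩)
      · exact mul_left_cancel₀ (pow_ne_zero 2 hp0) (by linear_combination e0)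
      · exact mul_left_cancel₀ (pow_ne_zero 2 hp0) (by linear_combination e1)
      · exact mul_left_cancel₀ hp0 (by linear_combination e2)

/-! ### The splitting criterion -/

lemma toZMod_eq_zero_iff {x : ℤ_[p]} : PadicInt.toZMod x = 0 ↔ (p : ℤ_[p]) ∣ x := by
  rw [← RingHom.mem_ker, PadicInt.ker_toZMod, PadicInt.maximalIdeal_eq_span_p,
    Ideal.mem_span_singleton]

lemma toZMod_ne_zero_iff {x : ℤ_[p]} : PadicInt.toZMod x ≠ 0 ↔ IsUnit x := by
  rw [isUnit_iff_not_dvd, Ne, toZMod_eq_zero_iff]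

lemma toZMod_eq_iff {x y : ℤ_[p]} :
    PadicInt.toZMod x = PadicInt.toZMod y ↔ (p : ℤ_[p]) ∣ x - y := by
  rw [← toZMod_eq_zero_iff, map_sub, sub_eq_zero]

lemma toZMod_surjective : Function.Surjective (PadicInt.toZMod (p := p)) := fun t => by
  have : NeZero p := ⟨(Fact.out : p.Prime).ne_zero⟩
  exact ⟨(t.val : ℤ_[p]), by simp⟩

lemma two_ne_zero_zmod (hp : p ≠ 2) : (2 : ZMod p) ≠ 0 := by
  rw [← Nat.cast_ofNat, Ne, ZMod.natCast_eq_zero_iff,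
    Nat.prime_dvd_prime_iff_eq Fact.out Nat.prime_two]
  exact hp

lemma isUnit_two (hp : p ≠ 2) : IsUnit (2 : ℤ_[p]) := by
  rw [← toZMod_ne_zero_iff, map_ofNat]
  exact two_ne_zero_zmod hp

lemma isUnit_four (hp : p ≠ 2) : IsUnit (4 : ℤ_[p]) := by
  rw [show (4 : ℤ_[p]) = 2 * 2 by norm_num]
  exact (isUnit_two hp).mul (isUnit_two hp)

/-- The quantity `a² - 4 d`, the discriminant of the residual quadratic `z² + a z + d`. -/
noncomputable def disc (y : Fin 3 → ℤ_[p]) : ℤ_[p] := y 2 ^ 2 - 4 * y 0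

lemma mem_splitSet_iff_disc (hp : p ≠ 2) {y : Fin 3 → ℤ_[p]} :
    y ∈ splitSet p ↔ ∃ σ ε : ℤ_[p], σ * ε = y 1 ∧
      ε ^ 2 = disc y + 2 * p * y 2 * σ ^ 2 + p ^ 2 * σ ^ 4 := by
  rw [mem_splitSet_iff]
  constructor
  · rintro ⟨σ, τ, τ', h0, h1, h2⟩
    refine ⟨σ, τ' - τ, h1, ?_⟩
    rw [disc, ← h0, ← h2]; ring
  · rintro ⟨σ, ε, h1, h2⟩
    obtain ⟨h, hh⟩ := (isUnit_two hp).exists_right_inv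
    refine ⟨σ, (y 2 + p * σ ^ 2 - ε) * h, (y 2 + p * σ ^ 2 + ε) * h, ?_, ?_, ?_⟩
    · rw [disc] at h2
      linear_combination -h ^ 2 * h2 + y 0 * (1 + 2 * h) * hh
    · linear_combination h1 + σ * ε * hh
    · linear_combination (y 2 + p * σ ^ 2) * hh

/-- If `D` is a unit and a square modulo `p`, Hensel's lemma lifts the solution of `x² = D`,
`x z = β` modulo `p` to any perturbation of these equations by multiples of `p`. -/
lemma exists_mul_eq_and_sq_eq (hp : p ≠ 2) {D : ℤ_[p]} (hD : IsUnit D)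
    (hsq : IsSquare (PadicInt.toZMod D)) (β A B G : ℤ_[p]) :
    ∃ x z : ℤ_[p], x * z = β ∧ x ^ 2 = D + p * (A * z ^ 2 + B * z ^ 4 + G * x ^ 4) := by
  obtain ⟨r, hr⟩ := hsq
  obtain ⟨x₀, rfl⟩ := toZMod_surjective r
  have hx₀ : PadicInt.toZMod x₀ ≠ 0 := fun h => toZMod_ne_zero_iff.2 hD (by rw [hr, h, zero_mul])
  have hp0 : PadicInt.toZMod (p : ℤ_[p]) = 0 := toZMod_eq_zero_iff.2 dvd_rfl
  -- `x⁴` times the second equation, after the substitution `z = β / x`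
  set F : ℤ_[p][X] := X ^ 6 - C D * X ^ 4 - C (p * (A * β ^ 2)) * X ^ 2 - C (p * (B * β ^ 4))
    - C (p * G) * X ^ 8 with hF
  have hF0 : ‖F.aeval x₀‖ < 1 := by
    rw [PadicInt.norm_lt_one_iff_dvd, ← toZMod_eq_zero_iff]
    simp [hF, hp0, hr]; ring
  have hF1 : ‖F.derivative.aeval x₀‖ = 1 := by
    rw [← PadicInt.isUnit_iff, ← toZMod_ne_zero_iff]
    have : PadicInt.toZMod (F.derivative.aeval x₀) =
        2 * PadicInt.toZMod x₀ ^ 5 := by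
      simp [hF, hp0, hr, map_ofNat]; ring
    rw [this]
    exact mul_ne_zero (two_ne_zero_zmod hp) (pow_ne_zero _ hx₀)
  obtain ⟨x, hx, hxx, -⟩ := hensels_lemma (F := F) (a := x₀) (by rw [hF1]; simpa using hF0)
  rw [hF1, PadicInt.norm_lt_one_iff_dvd, ← toZMod_eq_iff] at hxx
  obtain ⟨u, hu⟩ := (toZMod_ne_zero_iff.1 (hxx ▸ hx₀)).exists_right_inv
  refine ⟨x, β * u, by linear_combination β * hu, ?_⟩
  simp [hF] at hx
  have e2 : x ^ 2 * u ^ 2 = 1 := by rw [← mul_pow, hu, one_pow]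
  have e4 : x ^ 4 * u ^ 4 = 1 := by rw [← mul_pow, hu, one_pow]
  linear_combination u ^ 4 * hx + (-x ^ 2 + D + p * G * x ^ 4) * e4
    + p * A * β ^ 2 * u ^ 2 * e2

/-- For a unit `w`, the two terms of `ε² - p w σ²` have valuations of different parity, so there
is no cancellation. -/
lemma dvd_of_dvd_sq_sub {w : ℤ_[p]} (hw : IsUnit w) (n : ℕ) {ε σ : ℤ_[p]}
    (h : (p : ℤ_[p]) ^ (2 * n) ∣ ε ^ 2 - p * w * σ ^ 2) :
    (p : ℤ_[p]) ^ n ∣ ε ∧ (p : ℤ_[p]) ^ n ∣ σ := by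
  have hP := PadicInt.prime_p (p := p)
  induction n generalizing ε σ with
  | zero => simp
  | succ n ih =>
    have hε : (p : ℤ_[p]) ∣ ε := by
      refine hP.dvd_of_dvd_pow (n := 2) ?_
      have := dvd_add ((dvd_pow_self _ (by omega)).trans h)
        (⟨w * σ ^ 2, by ring⟩ : (p : ℤ_[p]) ∣ p * w * σ ^ 2)
      simpa using this
    obtain ⟨ε, rfl⟩ := hε
    obtain ⟨k, hk⟩ := h
    have hσ : (p : ℤ_[p]) ∣ σ := by
      refine hP.dvd_of_dvd_pow (n := 2) ?_
      refine (hw.dvd_mul_left).1 ⟨ε ^ 2 - p ^ (2 * n) * k, ?_⟩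
      refine mul_left_cancel₀ hP.ne_zero ?_
      rw [show 2 * (n + 1) = 2 * n + 2 by ring, pow_add] at hk
      linear_combination -hk
    obtain ⟨σ, rfl⟩ := hσ
    have := @ih ε σ ⟨k, ?_⟩
    · exact ⟨by rw [pow_succ']; exact mul_dvd_mul_left _ this.1,
        by rw [pow_succ']; exact mul_dvd_mul_left _ this.2⟩
    · refine mul_left_cancel₀ (pow_ne_zero 2 hP.ne_zero) ?_
      rw [show 2 * (n + 1) = 2 * n + 2 by ring, pow_add] at hk
      linear_combination hk

/-- The case of odd exponent: the term of odd valuation is the one which may be leading, so that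
`ε` gains a factor of `p`. -/
lemma dvd_of_dvd_sq_sub' {w : ℤ_[p]} (hw : IsUnit w) (n : ℕ) {ε σ : ℤ_[p]}
    (h : (p : ℤ_[p]) ^ (2 * n + 1) ∣ ε ^ 2 - p * w * σ ^ 2) :
    (p : ℤ_[p]) ^ (n + 1) ∣ ε ∧ (p : ℤ_[p]) ^ n ∣ σ := by
  have hP := PadicInt.prime_p (p := p)
  obtain ⟨⟨ε, rfl⟩, ⟨σ, rfl⟩⟩ := dvd_of_dvd_sq_sub hw n ((pow_dvd_pow _ (by omega)).trans h)
  refine ⟨?_, dvd_mul_right _ _⟩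
  rw [pow_succ]
  refine mul_dvd_mul_left _ (hP.dvd_of_dvd_pow (n := 2) ?_)
  obtain ⟨k, hk⟩ := h
  refine ⟨k + w * σ ^ 2, mul_left_cancel₀ (pow_ne_zero (2 * n) hP.ne_zero) ?_⟩
  rw [pow_succ] at hk
  linear_combination hk

/-- The factor by which the leading coefficient of `a² - 4 d`, of valuation `m`, has to be
multiplied in the splitting criterion. It is a unit for all `(d, b, a)` that matter, since `a` is
a unit when `d` is and `m ≥ 1`. -/
noncomputable def twist (m : ℕ) (a : ℤ_[p]) : ℤ_[p] := if Even m then 1 else -2 * a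

/-- The points `(d, b, a)` with `d` a unit, `a² - 4 d` of valuation exactly `m`, `v(b) ≥ m`, and
`a² - 4 d` satisfying the quadratic residue condition which makes the quartic split. -/
def splitLevel (p : ℕ) [Fact p.Prime] (m : ℕ) : Set (Fin 3 → ℤ_[p]) :=
  {y | IsUnit (y 0) ∧ (p : ℤ_[p]) ^ m ∣ y 1 ∧ ∃ Δ : ℤ_[p], IsUnit Δ ∧ disc y = p ^ m * Δ ∧
    IsSquare (PadicInt.toZMod (twist m (y 2) * Δ))}

lemma isUnit_iff_of_dvd_disc (hp : p ≠ 2) {y : Fin 3 → ℤ_[p]} (h : (p : ℤ_[p]) ∣ disc y) :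
    IsUnit (y 0) ↔ IsUnit (y 2) := by
  rw [← toZMod_eq_zero_iff, disc, map_sub, map_pow, map_mul, sub_eq_zero] at h
  have h4 : PadicInt.toZMod (4 : ℤ_[p]) ≠ 0 := toZMod_ne_zero_iff.2 (isUnit_four hp)
  rw [← toZMod_ne_zero_iff, ← toZMod_ne_zero_iff, ← pow_ne_zero_iff (n := 2) (by norm_num)
    (a := PadicInt.toZMod (y 2)), h, mul_ne_zero_iff]
  exact ⟨fun h => ⟨h4, h⟩, fun h => h.2⟩

lemma isUnit_two_mul_add (hp : p ≠ 2) {a : ℤ_[p]} (ha : IsUnit a) (s : ℤ_[p]) :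
    IsUnit (2 * a + p * s) := by
  rw [← toZMod_ne_zero_iff, map_add, toZMod_eq_zero_iff.2 (dvd_mul_right _ _), add_zero,
    toZMod_ne_zero_iff]
  exact (isUnit_two hp).mul ha

lemma splitLevel_subset_splitSet (hp : p ≠ 2) (m : ℕ) : splitLevel p m ⊆ splitSet p := by
  rintro y ⟨hd, ⟨β, hβ⟩, Δ, hΔ, hdisc, hsq⟩
  rw [mem_splitSet_iff_disc hp, hβ, hdisc]
  rcases Nat.even_or_odd' m with ⟨n, rfl | rfl⟩
  · rw [twist, if_pos (even_two_mul n), one_mul] at hsq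
    obtain ⟨x, z, hxz, hx⟩ := exists_mul_eq_and_sq_eq hp hΔ hsq β (2 * y 2) (p ^ (2 * n + 1)) 0
    refine ⟨p ^ n * z, p ^ n * x, ?_, ?_⟩
    · rw [← hxz]; ring
    · rw [mul_pow, hx]; ring
  · have ha : IsUnit (y 2) := (isUnit_iff_of_dvd_disc hp ⟨p ^ (2 * n) * Δ, by
      rw [hdisc]; ring⟩).1 hd
    rw [twist, if_neg (by simp)] at hsq
    obtain ⟨v, hv⟩ := ((isUnit_two hp).mul ha).exists_right_inv
    have hvu : IsUnit v := IsUnit.of_mul_eq_one_right _ hv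
    obtain ⟨x, z, hxz, hx⟩ := exists_mul_eq_and_sq_eq hp (D := -v * Δ)
      (hvu.neg.mul hΔ) (by
        have : -v * Δ = v * v * (-2 * y 2 * Δ) := by linear_combination v * Δ * hv
        rw [this, map_mul, map_mul]
        exact (IsSquare.mul_self _).mul hsq) β v 0 (-v * p ^ (2 * n))
    refine ⟨p ^ n * x, p ^ (n + 1) * z, ?_, ?_⟩
    · rw [← hxz]; ring
    · have hx' : 2 * y 2 * x ^ 2 = -Δ + p * z ^ 2 - p ^ (2 * n + 1) * x ^ 4 := by
        linear_combination 2 * y 2 * hx + (-Δ + p * z ^ 2 - p ^ (2 * n + 1) * x ^ 4) * hv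
      linear_combination -(p : ℤ_[p]) ^ (2 * n + 1) * hx'

lemma mem_splitLevel_of_mem_splitSet (hp : p ≠ 2) {y : Fin 3 → ℤ_[p]} (hd : IsUnit (y 0))
    (hy : y ∈ splitSet p) {m : ℕ} {Δ : ℤ_[p]} (hΔ : IsUnit Δ) (hdisc : disc y = p ^ m * Δ) :
    y ∈ splitLevel p m := by
  have hp0 := natCast_prime_ne_zero (p := p)
  obtain ⟨σ, ε, h1, h2⟩ := (mem_splitSet_iff_disc hp).1 hy
  rw [hdisc] at h2
  have h3 : ε ^ 2 - p * (2 * y 2 + p * σ ^ 2) * σ ^ 2 = p ^ m * Δ := by linear_combination h2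
  -- `a` need not be a unit for `m = 0`, where no divisibility has to be shown
  have key : m ≠ 0 → IsUnit (2 * y 2 + p * σ ^ 2) := fun hm => isUnit_two_mul_add hp
    ((isUnit_iff_of_dvd_disc hp (hdisc ▸ (dvd_pow_self _ hm).mul_right _)).1 hd) _
  have hpz : PadicInt.toZMod (p : ℤ_[p]) = 0 := toZMod_eq_zero_iff.2 dvd_rfl
  rcases Nat.even_or_odd' m with ⟨n, rfl | rfl⟩
  · have hdvd : (p : ℤ_[p]) ^ n ∣ ε ∧ (p : ℤ_[p]) ^ n ∣ σ := by
      rcases Nat.eq_zero_or_pos n with rfl | hn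
      · simp
      · exact dvd_of_dvd_sq_sub (key (by omega)) n ⟨Δ, h3⟩
    obtain ⟨⟨ε, rfl⟩, ⟨σ, rfl⟩⟩ := hdvd
    refine ⟨hd, ⟨σ * ε, by rw [← h1]; ring⟩, Δ, hΔ, hdisc, ?_⟩
    rw [twist, if_pos (even_two_mul n), one_mul]
    refine ⟨PadicInt.toZMod ε, ?_⟩
    have : Δ = ε * ε - p * ((2 * y 2 + p * (p ^ n * σ) ^ 2) * σ ^ 2) := by
      refine mul_left_cancel₀ (pow_ne_zero (2 * n) hp0) ?_
      linear_combination -h3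
    rw [this]
    simp [hpz]
  · obtain ⟨⟨ε, rfl⟩, ⟨σ, rfl⟩⟩ := dvd_of_dvd_sq_sub' (key (by omega)) n ⟨Δ, h3⟩
    refine ⟨hd, ⟨σ * ε, by rw [← h1]; ring⟩, Δ, hΔ, hdisc, ?_⟩
    rw [twist, if_neg (by simp)]
    refine ⟨PadicInt.toZMod (2 * y 2 * σ), ?_⟩
    have : Δ = p * (ε ^ 2 - (p ^ n * σ) ^ 2 * σ ^ 2) - 2 * y 2 * σ ^ 2 := by
      refine mul_left_cancel₀ (pow_ne_zero (2 * n + 1) hp0) ?_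
      linear_combination -h3
    rw [this]
    simp [hpz]
    ring

lemma splitSet_inter_units (hp : p ≠ 2) :
    {y | IsUnit (y 0)} ∩ splitSet p =
      (⋃ m, splitLevel p m) ∪ {y | IsUnit (y 0) ∧ y ∈ splitSet p ∧ disc y = 0} := by
  ext y
  constructor
  · rintro ⟨hd, hy⟩
    by_cases h : disc y = 0
    · exact Or.inr ⟨hd, hy, h⟩
    · left
      refine Set.mem_iUnion.2 ⟨(disc y).valuation, ?_⟩
      refine mem_splitLevel_of_mem_splitSet hp hd hy (PadicInt.unitCoeff h).isUnit ?_
      rw [mul_comm]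
      exact PadicInt.unitCoeff_spec h
  · rintro (h | ⟨h1, h2, -⟩)
    · obtain ⟨m, hm⟩ := Set.mem_iUnion.1 h
      exact ⟨hm.1, splitLevel_subset_splitSet hp m hm⟩
    · exact ⟨h1, h2⟩

lemma pow_mul_unit_inj {m n : ℕ} {x z : ℤ_[p]} (hx : IsUnit x) (hz : IsUnit z)
    (h : (p : ℤ_[p]) ^ m * x = p ^ n * z) : m = n := by
  have hp0 := natCast_prime_ne_zero (p := p)
  have := congrArg PadicInt.valuation h
  have hv : ∀ {u : ℤ_[p]}, IsUnit u → u.valuation = 0 := by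
    intro u hu
    have := PadicInt.norm_eq_zpow_neg_valuation hu.ne_zero
    rw [PadicInt.isUnit_iff.1 hu] at this
    have hp1 : (1 : ℝ) < p := by exact_mod_cast (Fact.out : p.Prime).one_lt
    have h3 := (zpow_eq_one_iff_right₀ (by positivity) hp1.ne').1 this.symm
    omega
  simpa [PadicInt.valuation_mul, hp0, hx.ne_zero, hz.ne_zero, hv hx, hv hz] using this

lemma pairwise_disjoint_splitLevel : Pairwise (Function.onFun Disjoint (splitLevel p)) := by
  intro m n hmn
  rw [Function.onFun, Set.disjoint_left]
  rintro y ⟨-, -, Δ, hΔ, h, -⟩ ⟨-, -, Δ', hΔ', h', -⟩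
  exact hmn (pow_mul_unit_inj hΔ hΔ' (h ▸ h'))

/-! ### Haar measure on `ℤ_p` and slicing of `ℤ_p³` -/

lemma isOpen_toZMod_preimage (T : Set (ZMod p)) :
    IsOpen (PadicInt.toZMod (p := p) ⁻¹' T) := by
  rw [Metric.isOpen_iff]
  intro x hx
  refine ⟨1, one_pos, fun z hz => ?_⟩
  rw [Metric.mem_ball, dist_eq_norm, PadicInt.norm_lt_one_iff_dvd, ← toZMod_eq_iff] at hz
  simpa [hz] using hx

lemma isClosed_toZMod_preimage (T : Set (ZMod p)) :
    IsClosed (PadicInt.toZMod (p := p) ⁻¹' T) := by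
  rw [← isOpen_compl_iff, ← Set.preimage_compl]
  exact isOpen_toZMod_preimage _

lemma setOf_isUnit_eq : {x : ℤ_[p] | IsUnit x} = PadicInt.toZMod ⁻¹' {0}ᶜ := by
  ext x
  exact toZMod_ne_zero_iff.symm

lemma setOf_dvd_eq (m : ℕ) : {x : ℤ_[p] | (p : ℤ_[p]) ^ m ∣ x} =
    (fun x => (p : ℤ_[p]) ^ m * x) '' Set.univ := by
  ext x
  simp [dvd_def, eq_comm]

lemma isClosed_setOf_dvd (m : ℕ) : IsClosed {x : ℤ_[p] | (p : ℤ_[p]) ^ m ∣ x} := by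
  rw [setOf_dvd_eq]
  exact (isCompact_univ.image (by fun_prop)).isClosed

lemma haarZp_toZMod_fibre (t : ZMod p) : haarZp p (PadicInt.toZMod ⁻¹' {t}) = (p : ℝ≥0∞)⁻¹ := by
  have hconst : ∀ t : ZMod p, haarZp p (PadicInt.toZMod ⁻¹' {t}) =
      haarZp p (PadicInt.toZMod ⁻¹' {0}) := by
    intro t
    obtain ⟨x, rfl⟩ := toZMod_surjective t
    rw [← measure_preimage_add (haarZp p) x]
    congr 1
    ext z
    simp
  have hun : haarZp p (⋃ t ∈ (Finset.univ : Finset (ZMod p)), PadicInt.toZMod ⁻¹' {t}) =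
      ∑ t : ZMod p, haarZp p (PadicInt.toZMod ⁻¹' {t}) := by
    refine measure_biUnion_finset ?_ fun t _ => (isOpen_toZMod_preimage _).measurableSet
    intro s _ t _ hst
    exact Disjoint.preimage _ (by simpa using hst)
  have huniv : (⋃ t ∈ (Finset.univ : Finset (ZMod p)), PadicInt.toZMod (p := p) ⁻¹' {t})
      = Set.univ := by ext; simp
  rw [huniv, measure_univ, Finset.sum_congr rfl fun t _ => hconst t, Finset.sum_const,
    Finset.card_univ, ZMod.card, nsmul_eq_mul] at hun
  rw [hconst]
  exact ENNReal.eq_inv_of_mul_eq_one_left (by rw [mul_comm]; exact hun.symm)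

lemma haarZp_toZMod_preimage (T : Finset (ZMod p)) :
    haarZp p (PadicInt.toZMod ⁻¹' (T : Set (ZMod p))) = T.card * (p : ℝ≥0∞)⁻¹ := by
  have : PadicInt.toZMod (p := p) ⁻¹' (T : Set (ZMod p)) = ⋃ t ∈ T, PadicInt.toZMod ⁻¹' {t} := by
    ext; simp
  rw [this, measure_biUnion_finset _ fun t _ => (isOpen_toZMod_preimage _).measurableSet]
  · simp [haarZp_toZMod_fibre]
  · intro s _ t _ hst
    exact Disjoint.preimage _ (by simpa using hst)

lemma range_prime_mul :
    Set.range (fun x : ℤ_[p] => (p : ℤ_[p]) * x) = PadicInt.toZMod ⁻¹' {0} := by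
  ext x
  rw [Set.mem_preimage, Set.mem_singleton_iff, toZMod_eq_zero_iff]
  simp [dvd_def, eq_comm]

lemma isOpenEmbedding_prime_mul : Topology.IsOpenEmbedding fun x : ℤ_[p] => (p : ℤ_[p]) * x := by
  refine ⟨(Continuous.isClosedEmbedding (by fun_prop)
    (mul_right_injective₀ natCast_prime_ne_zero)).isEmbedding, ?_⟩
  rw [range_prime_mul]
  exact isOpen_toZMod_preimage _

/-- Pulling back along multiplication by `p` gives a Haar measure, whose total mass is the measure
`1 / p` of `p ℤ_p`. -/
lemma haarZp_image_prime_mul (E : Set ℤ_[p]) :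
    haarZp p ((fun x => (p : ℤ_[p]) * x) '' E) = (p : ℝ≥0∞)⁻¹ * haarZp p E := by
  have he := isOpenEmbedding_prime_mul (p := p)
  set ν : Measure ℤ_[p] := (haarZp p).comap (AddMonoidHom.mulLeft (p : ℤ_[p])) with hν
  have : ν.IsAddHaarMeasure := Measure.IsAddHaarMeasure.comap (mH := inferInstance) _ he
  have happ : ∀ E, ν E = haarZp p ((fun x => (p : ℤ_[p]) * x) '' E) := fun E =>
    he.measurableEmbedding.comap_apply _ _
  have h := Measure.addHaarMeasure_unique ν (⊤ : TopologicalSpace.PositiveCompacts ℤ_[p])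
  have hun : ν (⊤ : TopologicalSpace.PositiveCompacts ℤ_[p]) = (p : ℝ≥0∞)⁻¹ := by
    rw [happ, TopologicalSpace.PositiveCompacts.coe_top, Set.image_univ, range_prime_mul,
      haarZp_toZMod_fibre]
  rw [← happ, h, hun]
  rfl

lemma haarZp_image_pow_mul (m : ℕ) (E : Set ℤ_[p]) :
    haarZp p ((fun x => (p : ℤ_[p]) ^ m * x) '' E) = (p : ℝ≥0∞)⁻¹ ^ m * haarZp p E := by
  induction m with
  | zero => simp
  | succ m ih =>
    rw [pow_succ' (p : ℝ≥0∞)⁻¹, mul_assoc, ← ih, ← haarZp_image_prime_mul, Set.image_image]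
    simp only [pow_succ', mul_assoc]

lemma haarZp_setOf_dvd (m : ℕ) :
    haarZp p {x | (p : ℤ_[p]) ^ m ∣ x} = (p : ℝ≥0∞)⁻¹ ^ m := by
  rw [setOf_dvd_eq, haarZp_image_pow_mul, measure_univ, mul_one]

lemma haarZp_setOf_isUnit : haarZp p {x | IsUnit x} = ((p - 1 : ℕ) : ℝ≥0∞) * (p : ℝ≥0∞)⁻¹ := by
  have : ({0}ᶜ : Set (ZMod p)) = (({0}ᶜ : Finset (ZMod p)) : Set (ZMod p)) := by simp
  rw [setOf_isUnit_eq, this, haarZp_toZMod_preimage, Finset.card_compl, ZMod.card,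
    Finset.card_singleton]

lemma measurePreserving_sub_mul {u : ℤ_[p]} (hu : IsUnit u) (c : ℤ_[p]) :
    MeasurePreserving (fun x => c - u * x) (haarZp p) (haarZp p) := by
  obtain ⟨u, rfl⟩ := hu
  have h1 : MeasurePreserving (AddMonoidHom.mulLeft (u : ℤ_[p])) (haarZp p) (haarZp p) :=
    AddMonoidHom.measurePreserving (by exact continuous_const_mul (u : ℤ_[p]))
      (fun x => ⟨(↑u⁻¹ : ℤ_[p]) * x, by simp⟩) (by simp)
  exact (Measure.measurePreserving_sub_left (haarZp p) c).comp h1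

instance instNullSingletonClassHaarZp : NullSingletonClass (haarZp p) := by
  refine ⟨fun x => ?_⟩
  have h0 : haarZp p {(0 : ℤ_[p])} = 0 := by
    refine le_antisymm (le_of_tendsto_of_tendsto' tendsto_const_nhds
      (ENNReal.tendsto_pow_atTop_nhds_zero_of_lt_one (r := (p : ℝ≥0∞)⁻¹) ?_) fun m => ?_) bot_le
    · exact ENNReal.inv_lt_one.2 (by exact_mod_cast (Fact.out : p.Prime).one_lt)
    · rw [← haarZp_setOf_dvd m]
      exact measure_mono (by simp)
  rw [← h0, ← measure_preimage_add (haarZp p) x {x}]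
  congr 1
  ext; simp

/-- The nonzero residues `t` for which `θ t` is a square. -/
noncomputable def squareClass (θ : ZMod p) : Finset (ZMod p) := by
  classical exact Finset.univ.filter fun t => t ≠ 0 ∧ IsSquare (θ * t)

lemma mem_squareClass {θ t : ZMod p} : t ∈ squareClass θ ↔ t ≠ 0 ∧ IsSquare (θ * t) := by
  simp [squareClass]

lemma two_mul_card_squareClass (hp : p ≠ 2) {θ : ZMod p} (hθ : θ ≠ 0) :
    2 * (squareClass θ).card = p - 1 := by
  classical
  have hsum : ∑ t : ZMod p, quadraticChar (ZMod p) (θ * t) = 0 := by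
    simp only [map_mul]
    rw [← Finset.mul_sum, quadraticChar_sum_zero (by rwa [ZMod.ringChar_zmod_n]), mul_zero]
  have hterm : ∀ t : ZMod p, quadraticChar (ZMod p) (θ * t) =
      2 * (if t ∈ squareClass θ then 1 else 0) - (if t ≠ 0 then 1 else 0) := by
    intro t
    simp only [mem_squareClass]
    by_cases ht : t = 0
    · simp [ht]
    · by_cases hs : IsSquare (θ * t)
      · simp [ht, hs, (quadraticChar_one_iff_isSquare (mul_ne_zero hθ ht)).2 hs]
      · simp [ht, hs, quadraticChar_neg_one_iff_not_isSquare.2 hs]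
  simp only [hterm, Finset.sum_sub_distrib, ← Finset.mul_sum, Finset.sum_boole] at hsum
  have h1 : (Finset.univ.filter fun t : ZMod p => t ≠ 0).card = p - 1 := by
    rw [Finset.filter_ne', Finset.card_erase_of_mem (Finset.mem_univ _), Finset.card_univ,
      ZMod.card]
  have h2 : (Finset.univ.filter fun t : ZMod p => t ∈ squareClass θ) = squareClass θ := by
    ext; simp
  rw [h1, h2] at hsum
  omega

/-- Fubini, slicing along the first coordinate, for a set all of whose nonempty slices have the
same measure and lie over a rectangle. -/
lemma haarZp3_eq_of_slices {E : Set (Fin 3 → ℤ_[p])} (hE : MeasurableSet E) {A B : Set ℤ_[p]}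
    (hB : MeasurableSet B) (hA : MeasurableSet A) {κ : ℝ≥0∞}
    (h : ∀ b ∈ B, ∀ a ∈ A, haarZp p {d | ![d, b, a] ∈ E} = κ)
    (h0 : ∀ y ∈ E, y 1 ∈ B ∧ y 2 ∈ A) :
    haarZp3 p E = κ * (haarZp p B * haarZp p A) := by
  have hmp := (measurePreserving_piFinSuccAbove (fun _ : Fin 3 => haarZp p) 0).symm
  rw [haarZp3, ← hmp.measure_preimage hE.nullMeasurableSet,
    Measure.prod_apply_symm (hmp.measurable hE)]
  have hR : MeasurableSet (Set.univ.pi ![B, A] : Set (Fin 2 → ℤ_[p])) :=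
    MeasurableSet.univ_pi fun i => by fin_cases i <;> assumption
  have hpi : Measure.pi (fun _ : Fin 2 => haarZp p) (Set.univ.pi ![B, A]) =
      haarZp p B * haarZp p A := by
    rw [Measure.pi_pi, Fin.prod_univ_two]; rfl
  rw [← hpi, ← lintegral_indicator_const hR]
  refine lintegral_congr fun z => ?_
  have hz : ∀ d, (MeasurableEquiv.piFinSuccAbove (fun _ : Fin 3 => ℤ_[p]) 0).symm (d, z) =
      ![d, z 0, z 1] := by
    intro d
    ext i
    fin_cases i <;> rfl
  have hset : (fun d => (d, z)) ⁻¹'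
      ((MeasurableEquiv.piFinSuccAbove (fun _ : Fin 3 => ℤ_[p]) 0).symm ⁻¹' E) =
      {d | ![d, z 0, z 1] ∈ E} := by
    ext d
    simp only [Set.mem_preimage, hz, Set.mem_ofPred_eq]
  rw [hset]
  by_cases hzR : z ∈ Set.univ.pi ![B, A]
  · rw [Set.indicator_of_mem hzR]
    exact h _ (hzR 0 trivial) _ (hzR 1 trivial)
  · rw [Set.indicator_of_notMem hzR]
    convert measure_empty (μ := haarZp p)
    refine Set.eq_empty_of_forall_notMem fun d hd => hzR fun i _ => ?_
    have := h0 _ hd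
    fin_cases i
    · exact this.1
    · exact this.2

/-! ### Measure of the reducible locus -/

lemma haarZp_disc_preimage (hp : p ≠ 2) (a : ℤ_[p]) {E : Set ℤ_[p]} (hE : MeasurableSet E) :
    haarZp p {d | a ^ 2 - 4 * d ∈ E} = haarZp p E :=
  (measurePreserving_sub_mul (isUnit_four hp) (a ^ 2)).measure_preimage hE.nullMeasurableSet

lemma isClosed_image_pow_mul (m : ℕ) (T : Set (ZMod p)) :
    IsClosed ((fun x : ℤ_[p] => (p : ℤ_[p]) ^ m * x) '' (PadicInt.toZMod ⁻¹' T)) :=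
  ((isClosed_toZMod_preimage T).isCompact.image (by fun_prop)).isClosed

/-- The distribution of `a² - 4 d` for fixed `a`: the probability that it has valuation `m` and a
leading coefficient in a given square class. -/
lemma haarZp_disc_slice (hp : p ≠ 2) (m : ℕ) (a θ : ℤ_[p]) (hθ : IsUnit θ) :
    haarZp p {d | ∃ Δ : ℤ_[p], IsUnit Δ ∧ a ^ 2 - 4 * d = p ^ m * Δ ∧
      IsSquare (PadicInt.toZMod (θ * Δ))} =
      (p : ℝ≥0∞)⁻¹ ^ m * (((p - 1) / 2 : ℕ) * (p : ℝ≥0∞)⁻¹) := by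
  have hcard : (squareClass (PadicInt.toZMod θ)).card = (p - 1) / 2 := by
    have := two_mul_card_squareClass hp (toZMod_ne_zero_iff.2 hθ)
    omega
  rw [← hcard, ← haarZp_toZMod_preimage, ← haarZp_image_pow_mul,
    ← haarZp_disc_preimage hp a (isClosed_image_pow_mul m _).measurableSet]
  congr 1
  ext d
  simp only [Set.mem_ofPred_eq, Set.mem_image, Set.mem_preimage, SetLike.mem_coe,
    mem_squareClass, toZMod_ne_zero_iff, map_mul]
  exact ⟨fun ⟨Δ, h1, h2, h3⟩ => ⟨Δ, ⟨h1, h3⟩, h2.symm⟩,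
    fun ⟨Δ, ⟨h1, h3⟩, h2⟩ => ⟨Δ, h1, h2.symm, h3⟩⟩

lemma continuous_disc : Continuous (disc (p := p)) := by
  unfold disc; fun_prop

lemma continuous_twist (m : ℕ) : Continuous (twist (p := p) m) := by
  unfold twist
  split_ifs <;> fun_prop

lemma isClosed_setOf_isUnit : IsClosed {x : ℤ_[p] | IsUnit x} := by
  rw [setOf_isUnit_eq]
  exact isClosed_toZMod_preimage _

/-- The level is the projection of a closed subset of a compact space, the fibre variable being the
leading coefficient of the discriminant. -/
lemma isClosed_splitLevel (m : ℕ) : IsClosed (splitLevel p m) := by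
  have htw := continuous_twist (p := p) m
  have hdc := continuous_disc (p := p)
  have hK : IsClosed {q : (Fin 3 → ℤ_[p]) × ℤ_[p] | IsUnit (q.1 0) ∧ (p : ℤ_[p]) ^ m ∣ q.1 1 ∧
      IsUnit q.2 ∧ disc q.1 = p ^ m * q.2 ∧
      IsSquare (PadicInt.toZMod (twist m (q.1 2) * q.2))} := by
    refine (isClosed_setOf_isUnit.preimage (f := fun q : (Fin 3 → ℤ_[p]) × ℤ_[p] => q.1 0)
      (by fun_prop)).inter (((isClosed_setOf_dvd m).preimage
        (f := fun q : (Fin 3 → ℤ_[p]) × ℤ_[p] => q.1 1) (by fun_prop)).inter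
      ((isClosed_setOf_isUnit.preimage (f := fun q : (Fin 3 → ℤ_[p]) × ℤ_[p] => q.2)
        (by fun_prop)).inter ((isClosed_eq (by fun_prop) (by fun_prop)).inter
      ((isClosed_toZMod_preimage {t | IsSquare t}).preimage
        (f := fun q : (Fin 3 → ℤ_[p]) × ℤ_[p] => twist m (q.1 2) * q.2) (by fun_prop)))))
  convert (hK.isCompact.image continuous_fst).isClosed using 1
  ext y
  constructor
  · rintro ⟨h1, h2, Δ, h3, h4, h5⟩
    exact ⟨(y, Δ), ⟨h1, h2, h3, h4, h5⟩, rfl⟩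
  · rintro ⟨⟨y, Δ⟩, ⟨h1, h2, h3, h4, h5⟩, rfl⟩
    exact ⟨h1, h2, Δ, h3, h4, h5⟩

lemma haarZp3_splitLevel_succ (hp : p ≠ 2) (m : ℕ) :
    haarZp3 p (splitLevel p (m + 1)) =
      (p : ℝ≥0∞)⁻¹ ^ (m + 1) * (((p - 1) / 2 : ℕ) * (p : ℝ≥0∞)⁻¹) *
        ((p : ℝ≥0∞)⁻¹ ^ (m + 1) * ((p - 1 : ℕ) * (p : ℝ≥0∞)⁻¹)) := by
  have hunit : ∀ {y : Fin 3 → ℤ_[p]} {Δ : ℤ_[p]}, disc y = p ^ (m + 1) * Δ →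
      (IsUnit (y 0) ↔ IsUnit (y 2)) := fun h =>
    isUnit_iff_of_dvd_disc hp (h ▸ (dvd_pow_self _ m.succ_ne_zero).mul_right _)
  rw [← haarZp_setOf_dvd (m + 1), ← haarZp_setOf_isUnit]
  refine (haarZp3_eq_of_slices (isClosed_splitLevel _).measurableSet
    (isClosed_setOf_dvd _).measurableSet isClosed_setOf_isUnit.measurableSet
    (fun b hb a ha => ?_) ?_).trans (by rw [haarZp_setOf_dvd])
  · have hθ : IsUnit (twist (m + 1) a) := by
      unfold twist
      split_ifs
      · exact isUnit_one
      · exact (isUnit_two hp).neg.mul ha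
    rw [← haarZp_disc_slice hp (m + 1) a _ hθ]
    congr 1
    ext d
    constructor
    · rintro ⟨-, -, h⟩
      exact h
    · rintro ⟨Δ, h1, h2, h3⟩
      exact ⟨(hunit (y := ![d, b, a]) h2).2 ha, hb, Δ, h1, h2, h3⟩
  · rintro y ⟨h1, h2, Δ, -, h3, -⟩
    exact ⟨h2, (hunit h3).1 h1⟩

/-- Among the points with `a² - 4 d` a nonzero square modulo `p`, those with `d` not a unit are
exactly those with `p ∣ d` and `a` a unit. -/
lemma haarZp3_splitLevel_zero_add (hp : p ≠ 2) :
    haarZp3 p (splitLevel p 0) + (p : ℝ≥0∞)⁻¹ * ((p - 1 : ℕ) * (p : ℝ≥0∞)⁻¹) =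
      ((p - 1) / 2 : ℕ) * (p : ℝ≥0∞)⁻¹ := by
  set U : Set (Fin 3 → ℤ_[p]) := {y | ∃ Δ : ℤ_[p], IsUnit Δ ∧ y 2 ^ 2 - 4 * y 0 = p ^ 0 * Δ ∧
      IsSquare (PadicInt.toZMod (1 * Δ))} with hU
  set V : Set (Fin 3 → ℤ_[p]) := {y | (p : ℤ_[p]) ^ 1 ∣ y 0 ∧ IsUnit (y 2)} with hV
  have hVm : MeasurableSet V :=
    (((isClosed_setOf_dvd 1).preimage (f := fun y : Fin 3 → ℤ_[p] => y 0) (by fun_prop)).inter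
      (isClosed_setOf_isUnit.preimage (f := fun y : Fin 3 → ℤ_[p] => y 2)
        (by fun_prop))).measurableSet
  have hunion : U = splitLevel p 0 ∪ V := by
    have hVU : ∀ y ∈ V, y ∈ U := by
      rintro y ⟨h1, h2⟩
      have h : PadicInt.toZMod (y 2 ^ 2 - 4 * y 0) = PadicInt.toZMod (y 2) ^ 2 := by
        rw [map_sub, map_mul, (toZMod_eq_zero_iff (x := y 0)).2 (by simpa using h1), mul_zero,
          sub_zero, map_pow]
      refine ⟨y 2 ^ 2 - 4 * y 0, ?_, by simp, ?_⟩
      · rw [← toZMod_ne_zero_iff, h]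
        exact pow_ne_zero _ (toZMod_ne_zero_iff.2 h2)
      · rw [one_mul, h, sq]
        exact IsSquare.mul_self _
    ext y
    constructor
    · rintro ⟨Δ, h1, h2, h3⟩
      by_cases hy : IsUnit (y 0)
      · refine Or.inl ⟨hy, by simp, Δ, h1, h2, ?_⟩
        rwa [twist, if_pos Even.zero]
      · right
        rw [isUnit_iff_not_dvd, not_not] at hy
        refine ⟨by simpa using hy, ?_⟩
        rw [← toZMod_eq_zero_iff] at hy
        rw [← toZMod_ne_zero_iff] at h1 ⊢
        intro ha
        apply h1
        have := congrArg PadicInt.toZMod h2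
        simpa [hy, ha] using this.symm
    · rintro (⟨-, -, Δ, h1, h2, h3⟩ | hy)
      · refine ⟨Δ, h1, h2, ?_⟩
        rwa [twist, if_pos Even.zero] at h3
      · exact hVU y hy
  have hdisj : Disjoint (splitLevel p 0) V := by
    rw [Set.disjoint_left]
    rintro y ⟨h, -⟩ ⟨h', -⟩
    exact isUnit_iff_not_dvd.1 h (by simpa using h')
  have hUm : MeasurableSet U := hunion ▸ (isClosed_splitLevel 0).measurableSet.union hVm
  have hUmeas : haarZp3 p U = ((p - 1) / 2 : ℕ) * (p : ℝ≥0∞)⁻¹ := by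
    rw [haarZp3_eq_of_slices hUm MeasurableSet.univ MeasurableSet.univ
      (fun b _ a _ => haarZp_disc_slice hp 0 a 1 isUnit_one) (by simp)]
    simp
  have hVmeas : haarZp3 p V = (p : ℝ≥0∞)⁻¹ * ((p - 1 : ℕ) * (p : ℝ≥0∞)⁻¹) := by
    rw [haarZp3_eq_of_slices (κ := (p : ℝ≥0∞)⁻¹) hVm MeasurableSet.univ
      isClosed_setOf_isUnit.measurableSet (fun b _ a ha => ?_) (fun y hy => ⟨trivial, hy.2⟩)]
    · rw [measure_univ, one_mul, haarZp_setOf_isUnit]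
    · have : {d | ![d, b, a] ∈ V} = {d : ℤ_[p] | (p : ℤ_[p]) ^ 1 ∣ d} := by
        ext d
        exact ⟨fun h => h.1, fun h => ⟨h, ha⟩⟩
      rw [this, haarZp_setOf_dvd, pow_one]
  rw [← hVmeas, ← measure_union hdisj hVm, ← hunion, hUmeas]

lemma haarZp3_disc_eq_zero (hp : p ≠ 2) : haarZp3 p {y | disc y = 0} = 0 := by
  rw [haarZp3_eq_of_slices (κ := 0) (isClosed_eq continuous_disc continuous_const).measurableSet
    MeasurableSet.univ MeasurableSet.univ (fun b _ a _ => ?_) (by simp), zero_mul]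
  refine (haarZp_disc_preimage hp a (measurableSet_singleton 0)).trans (measure_singleton _)

lemma measurableSet_units : MeasurableSet {y : Fin 3 → ℤ_[p] | IsUnit (y 0)} :=
  (isClosed_setOf_isUnit.preimage (f := fun y : Fin 3 → ℤ_[p] => y 0)
    (by fun_prop)).measurableSet

lemma haarZp3_setOf_isUnit :
    haarZp3 p {y | IsUnit (y 0)} = (p - 1 : ℕ) * (p : ℝ≥0∞)⁻¹ := by
  have h := haarZp3_eq_of_slices (κ := (p - 1 : ℕ) * (p : ℝ≥0∞)⁻¹)
    (measurableSet_units (p := p)) MeasurableSet.univ MeasurableSet.univ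
    (fun b _ a _ => haarZp_setOf_isUnit) (by simp)
  rw [h, measure_univ, mul_one, mul_one]

lemma isCompact_splitSet : IsCompact (splitSet p) := isCompact_range (by fun_prop)

lemma haarZp3_real_units : (haarZp3 p).real {y | IsUnit (y 0)} = ((p : ℝ) - 1) / p := by
  have h1 : 1 ≤ p := (Fact.out : p.Prime).one_le
  rw [measureReal_def, haarZp3_setOf_isUnit]
  rw [ENNReal.toReal_mul, ENNReal.toReal_inv, ENNReal.toReal_natCast, ENNReal.toReal_natCast,
    Nat.cast_sub h1, Nat.cast_one, div_eq_mul_inv]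

lemma haarZp3_real_units_inter_splitSet (hp : p ≠ 2) :
    (haarZp3 p).real ({y | IsUnit (y 0)} ∩ splitSet p) =
      ((p : ℝ) - 1) * (p ^ 2 - p - 1) / (2 * p ^ 2 * (p + 1)) := by
  have hpp : p.Prime := Fact.out
  have h1 : 1 ≤ p := hpp.one_le
  have hp1 : (1 : ℝ) < p := by exact_mod_cast hpp.one_lt
  have hN : (((p - 1) / 2 : ℕ) : ℝ) = ((p : ℝ) - 1) / 2 := by
    have h2 : 2 * ((p - 1) / 2) = p - 1 := by
      have := hpp.eq_two_or_odd
      omega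
    have h3 : (2 : ℝ) * ((p - 1) / 2 : ℕ) = ((p - 1 : ℕ) : ℝ) := by exact_mod_cast h2
    rw [Nat.cast_sub h1, Nat.cast_one] at h3
    linarith
  have hmeas : haarZp3 p ({y | IsUnit (y 0)} ∩ splitSet p) = ∑' m, haarZp3 p (splitLevel p m) := by
    rw [splitSet_inter_units hp, measure_congr (union_ae_eq_left_of_ae_eq_empty (ae_eq_empty.2
      (measure_mono_null (fun y hy => hy.2.2) (haarZp3_disc_eq_zero hp)))), measure_iUnion
      pairwise_disjoint_splitLevel fun m => (isClosed_splitLevel m).measurableSet]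
  have hfin : ∀ m, haarZp3 p (splitLevel p m) ≠ ⊤ := fun m => measure_ne_top _ _
  have hsucc : ∀ m, (haarZp3 p).real (splitLevel p (m + 1)) =
      (((p : ℝ) - 1) ^ 2 / (2 * p ^ 4)) * (((p : ℝ) ^ 2)⁻¹) ^ m := by
    intro m
    rw [measureReal_def, haarZp3_splitLevel_succ hp]
    simp only [ENNReal.toReal_mul, ENNReal.toReal_pow, ENNReal.toReal_inv, ENNReal.toReal_natCast,
      hN, Nat.cast_sub h1, Nat.cast_one]
    have hq : (((p : ℝ) ^ 2)⁻¹) ^ m = ((p : ℝ)⁻¹ ^ m) ^ 2 := by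
      rw [← inv_pow, ← pow_mul, ← pow_mul, mul_comm]
    rw [hq, pow_succ]
    generalize (p : ℝ)⁻¹ ^ m = q
    field_simp
  have hzero : (haarZp3 p).real (splitLevel p 0) = ((p : ℝ) - 1) * (p - 2) / (2 * p ^ 2) := by
    have h := congrArg ENNReal.toReal (haarZp3_splitLevel_zero_add hp)
    rw [ENNReal.toReal_add (hfin 0) (by
      simp [ENNReal.mul_eq_top, hpp.ne_zero])] at h
    simp only [ENNReal.toReal_mul, ENNReal.toReal_inv, ENNReal.toReal_natCast,
      hN, Nat.cast_sub h1, Nat.cast_one] at h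
    rw [measureReal_def, eq_sub_of_add_eq h]
    field_simp
  have hlt : ((p : ℝ) ^ 2)⁻¹ < 1 := inv_lt_one_of_one_lt₀ (one_lt_pow₀ hp1 two_ne_zero)
  have hgeom := (hasSum_geometric_of_lt_one (by positivity) hlt).mul_left
    (((p : ℝ) - 1) ^ 2 / (2 * p ^ 4))
  have hsum : HasSum (fun m => (haarZp3 p).real (splitLevel p m))
      ((((p : ℝ) - 1) ^ 2 / (2 * p ^ 4)) * (1 - ((p : ℝ) ^ 2)⁻¹)⁻¹ +
        ((p : ℝ) - 1) * (p - 2) / (2 * p ^ 2)) := by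
    rw [← hasSum_nat_add_iff' 1]
    simpa [hsucc, hzero] using hgeom
  rw [measureReal_def, hmeas, ENNReal.tsum_toReal_eq hfin]
  refine hsum.tsum_eq.trans ?_
  have : (p : ℝ) ^ 2 - 1 ≠ 0 := by nlinarith
  have h3 : (1 - ((p : ℝ) ^ 2)⁻¹) = ((p : ℝ) - 1) * (p + 1) / p ^ 2 := by
    field_simp; ring
  have h4 : (p : ℝ) - 1 ≠ 0 := by linarith
  rw [h3]
  field_simp
  ring

/-! ### The Newton polygon -/

lemma mem_newtonPoints_quartic_iff {c : Fin 3 → ℤ_[p]} {P : ℝ × ℝ} :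
    P ∈ newtonPoints (quartic c) ↔ P = (4, 0) ∨ (∃ j : ℕ, vp (c 0) = j ∧ P = (0, (j : ℝ))) ∨
      (∃ j : ℕ, vp (c 1) = j ∧ P = (1, (j : ℝ))) ∨
      (∃ j : ℕ, vp (c 2) = j ∧ P = (2, (j : ℝ))) := by
  have h1 : vp (1 : ℤ_[p]) = (0 : ℕ) := by
    rw [vp_eq_iff]
    simpa using isUnit_iff_not_dvd.1 (isUnit_one (M := ℤ_[p]))
  constructor
  · rintro ⟨i, j, hj, rfl⟩
    rw [coeff_quartic] at hj
    split_ifs at hj with h0 h1' h2 h4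
    · exact Or.inr (Or.inl ⟨j, hj, by simp [h0]⟩)
    · exact Or.inr (Or.inr (Or.inl ⟨j, hj, by simp [h1']⟩))
    · exact Or.inr (Or.inr (Or.inr ⟨j, hj, by simp [h2]⟩))
    · left
      rw [h1] at hj
      have : j = 0 := by exact_mod_cast hj.symm
      simp [h4, this]
    · simp [vp] at hj
  · rintro (rfl | ⟨j, hj, rfl⟩ | ⟨j, hj, rfl⟩ | ⟨j, hj, rfl⟩)
    · exact ⟨4, 0, by simpa [coeff_quartic] using h1, by simp⟩
    · exact ⟨0, j, by simpa [coeff_quartic] using hj, by simp⟩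
    · exact ⟨1, j, by simpa [coeff_quartic] using hj, by simp⟩
    · exact ⟨2, j, by simpa [coeff_quartic] using hj, by simp⟩

lemma mem_segment_iff {P : ℝ × ℝ} :
    P ∈ segment ℝ ((0, 2) : ℝ × ℝ) ((4, 0) : ℝ × ℝ) ↔
      0 ≤ P.1 ∧ P.1 ≤ 4 ∧ P.2 = 2 - P.1 / 2 := by
  constructor
  · rintro ⟨a, b, ha, hb, hab, rfl⟩
    simp
    refine ⟨hb, by linarith, by linarith⟩
  · rintro ⟨h0, h4, h⟩
    refine ⟨1 - P.1 / 4, P.1 / 4, by linarith, by linarith, by ring, ?_⟩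
    ext
    · simp
    · simp [h]; ring

lemma convex_halfPlane (α β γ : ℝ) : Convex ℝ {P : ℝ × ℝ | γ ≤ α * P.1 + β * P.2} :=
  convex_halfSpace_ge (f := fun P : ℝ × ℝ => α * P.1 + β * P.2)
    ⟨fun _ _ => by simp; ring, fun _ _ => by simp; ring⟩ γ

/-- A linear inequality valid on a set is valid on its convex hull. -/
lemma le_of_mem_convexHull {s : Set (ℝ × ℝ)} {α β γ : ℝ}
    (h : ∀ P ∈ s, γ ≤ α * P.1 + β * P.2) {P : ℝ × ℝ} (hP : P ∈ convexHull ℝ s) :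
    γ ≤ α * P.1 + β * P.2 :=
  convexHull_min h (convex_halfPlane α β γ) hP

lemma newtonPolygon_eq_segment_of_mem {c : Fin 3 → ℤ_[p]} (hc : c ∈ slopeHalf p) :
    newtonPolygon (quartic c) = segment ℝ ((0, 2) : ℝ × ℝ) ((4, 0) : ℝ × ℝ) := by
  obtain ⟨h0, h1, h2⟩ := hc
  have hlow : ∀ P ∈ newtonPoints (quartic c), (2 : ℝ) ≤ (1 / 2) * P.1 + 1 * P.2 := by
    intro P hP
    rcases mem_newtonPoints_quartic_iff.1 hP with rfl | ⟨j, hj, rfl⟩ | ⟨j, hj, rfl⟩ | ⟨j, hj, rfl⟩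
    · norm_num
    · have : j = 2 := by rw [h0] at hj; exact_mod_cast hj.symm
      simp [this]
    · have : 2 ≤ j := by rw [hj] at h1; exact_mod_cast h1
      have : (2 : ℝ) ≤ j := by exact_mod_cast this
      simp; linarith
    · have : 1 ≤ j := by rw [hj] at h2; exact_mod_cast h2
      have : (1 : ℝ) ≤ j := by exact_mod_cast this
      simp; linarith
  have hleft : ∀ P ∈ newtonPoints (quartic c), (0 : ℝ) ≤ 1 * P.1 + 0 * P.2 := by
    rintro _ ⟨i, j, -, rfl⟩
    simp
  have hright : ∀ P ∈ newtonPoints (quartic c), (-4 : ℝ) ≤ (-1) * P.1 + 0 * P.2 := by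
    intro P hP
    rcases mem_newtonPoints_quartic_iff.1 hP with rfl | ⟨j, hj, rfl⟩ | ⟨j, hj, rfl⟩ | ⟨j, hj, rfl⟩ <;>
      norm_num
  have hseg : segment ℝ ((0, 2) : ℝ × ℝ) ((4, 0) : ℝ × ℝ) ⊆
      convexHull ℝ (newtonPoints (quartic c)) := by
    refine segment_subset_convexHull ?_ ?_
    · exact mem_newtonPoints_quartic_iff.2 (Or.inr (Or.inl ⟨2, h0, by simp⟩))
    · exact mem_newtonPoints_quartic_iff.2 (Or.inl rfl)
  ext P
  rw [mem_segment_iff]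
  constructor
  · rintro ⟨hP, hmin⟩
    have a1 := le_of_mem_convexHull hlow hP
    have a2 := le_of_mem_convexHull hleft hP
    have a3 := le_of_mem_convexHull hright hP
    refine ⟨by linarith, by linarith, ?_⟩
    by_contra hne
    have hlt : 2 - P.1 / 2 < P.2 := lt_of_le_of_ne (by linarith) (Ne.symm hne)
    exact hmin _ hlt (hseg (mem_segment_iff.2 ⟨by linarith, by linarith, rfl⟩))
  · rintro hP
    refine ⟨hseg (mem_segment_iff.2 hP), fun z hz hmem => ?_⟩
    have := le_of_mem_convexHull hlow hmem
    simp only at this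
    linarith [hP.2.2]

lemma mem_slopeHalf_of_newtonPolygon {c : Fin 3 → ℤ_[p]}
    (h : newtonPolygon (quartic c) = segment ℝ ((0, 2) : ℝ × ℝ) ((4, 0) : ℝ × ℝ)) :
    c ∈ slopeHalf p := by
  have hmem : ∀ x : ℝ, 0 ≤ x → x ≤ 4 → (x, 2 - x / 2) ∈ newtonPolygon (quartic c) := by
    intro x h0 h4
    rw [h]
    exact mem_segment_iff.2 ⟨h0, h4, rfl⟩
  -- no vertex lies strictly below the segment
  have hge : ∀ x y : ℝ, (x, y) ∈ newtonPoints (quartic c) → 0 ≤ x → x ≤ 4 → 2 - x / 2 ≤ y := by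
    intro x y hxy h0 h4
    by_contra hlt
    exact (hmem x h0 h4).2 y (not_le.1 hlt) (subset_convexHull ℝ _ hxy)
  have hnat : ∀ (n : ℕ) (v : ℕ∞), (∀ j : ℕ, v = j → n ≤ j) → (n : ℕ∞) ≤ v := by
    intro n v hv
    induction v using ENat.recTopCoe with
    | top => exact le_top
    | coe j => exact_mod_cast hv j rfl
  refine ⟨?_, hnat 2 _ fun j hj => ?_, hnat 1 _ fun j hj => ?_⟩
  · by_contra hne
    -- otherwise `y + 3 x ≥ 3` on all the points, hence on the hull, which contains `(0, 2)`
    have h3 : ∀ P ∈ newtonPoints (quartic c), (3 : ℝ) ≤ 3 * P.1 + 1 * P.2 := by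
      intro P hP
      rcases mem_newtonPoints_quartic_iff.1 hP with
        rfl | ⟨j, hj, rfl⟩ | ⟨j, hj, rfl⟩ | ⟨j, hj, rfl⟩
      · norm_num
      · have h2 := hge _ _ hP le_rfl (by norm_num)
        have h2' : 2 ≤ j := by
          have : (2 : ℝ) ≤ j := by linarith
          exact_mod_cast this
        have hj2 : j ≠ 2 := by
          rintro rfl
          exact hne hj
        have : 3 ≤ j := by omega
        have : (3 : ℝ) ≤ j := by exact_mod_cast this
        simp; linarith
      · have : (0 : ℝ) ≤ j := by positivity
        simp
      · have : (0 : ℝ) ≤ j := by positivity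
        simp; linarith
    have := le_of_mem_convexHull h3 (hmem 0 le_rfl (by norm_num)).1
    norm_num at this
  · have := hge 1 j (mem_newtonPoints_quartic_iff.2 (Or.inr (Or.inr (Or.inl ⟨j, hj, rfl⟩))))
      (by norm_num) (by norm_num)
    have h1 : (1 : ℝ) < j := by linarith
    exact_mod_cast h1
  · have := hge 2 j (mem_newtonPoints_quartic_iff.2 (Or.inr (Or.inr (Or.inr ⟨j, hj, rfl⟩))))
      (by norm_num) (by norm_num)
    have h1 : (0 : ℝ) < j := by linarith
    exact_mod_cast h1

/-! ### Scaling and the proportion of irreducible quartics -/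

lemma scale_injective : Function.Injective (scale (p := p)) := by
  have hp0 := natCast_prime_ne_zero (p := p)
  intro y z h
  ext i
  have := congrFun h i
  fin_cases i <;> simpa [scale, hp0] using this

/-- `scale` as a homomorphism of additive groups. -/
noncomputable def scaleHom (p : ℕ) [Fact p.Prime] : (Fin 3 → ℤ_[p]) →+ (Fin 3 → ℤ_[p]) where
  toFun := scale
  map_zero' := by ext i; fin_cases i <;> simp [scale]
  map_add' y z := by ext i; fin_cases i <;> simp [scale, mul_add]

lemma continuous_scale : Continuous (scale (p := p)) := by
  unfold scale; fun_prop

lemma isOpenEmbedding_scale : Topology.IsOpenEmbedding (scale (p := p)) := by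
  refine ⟨(continuous_scale.isClosedEmbedding scale_injective).isEmbedding, ?_⟩
  have hopen : ∀ m : ℕ, IsOpen {x : ℤ_[p] | (p : ℤ_[p]) ^ m ∣ x} := by
    intro m
    induction m with
    | zero => simp
    | succ m ih =>
      convert isOpenEmbedding_prime_mul.isOpenMap _ ih using 1
      ext x
      constructor
      · rintro ⟨k, rfl⟩
        exact ⟨p ^ m * k, dvd_mul_right _ _, by ring⟩
      · rintro ⟨_, ⟨k, rfl⟩, rfl⟩
        exact ⟨k, by ring⟩
  have : Set.range (scale (p := p)) = {c | (p : ℤ_[p]) ^ 2 ∣ c 0} ∩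
      ({c | (p : ℤ_[p]) ^ 2 ∣ c 1} ∩ {c | (p : ℤ_[p]) ^ 1 ∣ c 2}) := by
    ext c
    constructor
    · rintro ⟨y, rfl⟩
      exact ⟨⟨y 0, rfl⟩, ⟨y 1, rfl⟩, ⟨y 2, by simp [scale]⟩⟩
    · rintro ⟨⟨d, hd⟩, ⟨b, hb⟩, ⟨a, ha⟩⟩
      refine ⟨![d, b, a], ?_⟩
      ext i
      fin_cases i <;> simp [scale, hd, hb, ha]
  rw [this]
  have hpre : ∀ (m : ℕ) (i : Fin 3), IsOpen {c : Fin 3 → ℤ_[p] | (p : ℤ_[p]) ^ m ∣ c i} :=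
    fun m i => (hopen m).preimage (f := fun c : Fin 3 → ℤ_[p] => c i) (by fun_prop)
  exact (hpre 2 0).inter ((hpre 2 1).inter (hpre 1 2))

/-- The image under `scale` multiplies the Haar measure by a nonzero constant, because the
pullback of a Haar measure along an open embedding of groups is a Haar measure. -/
lemma exists_haarZp3_image_scale : ∃ κ : ENNReal, κ ≠ 0 ∧
    ∀ E : Set (Fin 3 → ℤ_[p]), haarZp3 p (scale '' E) = κ * haarZp3 p E := by
  have he := isOpenEmbedding_scale (p := p)
  have : (haarZp3 p).IsAddHaarMeasure := by unfold haarZp3; infer_instance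
  set ν : Measure (Fin 3 → ℤ_[p]) := (haarZp3 p).comap (scaleHom p) with hν
  have : ν.IsAddHaarMeasure := Measure.IsAddHaarMeasure.comap (mH := inferInstance) _ he
  have happ : ∀ E, ν E = haarZp3 p (scale '' E) := fun E =>
    he.measurableEmbedding.comap_apply _ _
  have h1 := Measure.addHaarMeasure_unique ν
    (⊤ : TopologicalSpace.PositiveCompacts (Fin 3 → ℤ_[p]))
  have h2 := Measure.addHaarMeasure_unique (haarZp3 p)
    (⊤ : TopologicalSpace.PositiveCompacts (Fin 3 → ℤ_[p]))
  rw [TopologicalSpace.PositiveCompacts.coe_top, measure_univ, one_smul] at h2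
  rw [← h2, TopologicalSpace.PositiveCompacts.coe_top] at h1
  refine ⟨ν Set.univ, isOpen_univ.measure_ne_zero ν Set.univ_nonempty, fun E => ?_⟩
  rw [← happ]
  conv_lhs => rw [h1]
  rfl

lemma slopeHalf_inter_irreducibleQuartics :
    slopeHalf p ∩ irreducibleQuartics p = scale '' ({y | IsUnit (y 0)} \ splitSet p) := by
  rw [slopeHalf_eq_image]
  ext c
  constructor
  · rintro ⟨⟨y, hy, rfl⟩, hc⟩
    exact ⟨y, ⟨hy, (irreducible_quartic_scale_iff hy).1 hc⟩, rfl⟩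
  · rintro ⟨y, ⟨hy, hns⟩, rfl⟩
    exact ⟨⟨y, hy, rfl⟩, (irreducible_quartic_scale_iff hy).2 hns⟩

lemma measurableSet_slopeHalf : MeasurableSet (slopeHalf p) := by
  rw [slopeHalf_eq_image]
  exact isOpenEmbedding_scale.measurableEmbedding.measurableSet_image.2 measurableSet_units

lemma measurableSet_slopeHalf_inter_irreducibleQuartics :
    MeasurableSet (slopeHalf p ∩ irreducibleQuartics p) := by
  rw [slopeHalf_inter_irreducibleQuartics]
  exact isOpenEmbedding_scale.measurableEmbedding.measurableSet_image.2
    (measurableSet_units.diff isCompact_splitSet.isClosed.measurableSet)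

lemma haarZp3_slopeHalf_pos : 0 < haarZp3 p (slopeHalf p) := by
  obtain ⟨κ, hκ, h⟩ := exists_haarZp3_image_scale (p := p)
  rw [slopeHalf_eq_image, h, haarZp3_setOf_isUnit, pos_iff_ne_zero]
  have h1 : (p - 1 : ℕ) ≠ 0 := by
    have := (Fact.out : p.Prime).two_le
    omega
  exact mul_ne_zero hκ (mul_ne_zero (by exact_mod_cast h1)
    (ENNReal.inv_ne_zero.2 (ENNReal.natCast_ne_top p)))

lemma proportion_irreducibleQuartics (hp : p ≠ 2) :
    proportion p (irreducibleQuartics p) (slopeHalf p) =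
      ((p : ℝ) ^ 2 + 3 * p + 1) / (2 * p * (p + 1)) := by
  obtain ⟨κ, hκ, h⟩ := exists_haarZp3_image_scale (p := p)
  have hκ' : κ.toReal ≠ 0 := by
    refine ENNReal.toReal_ne_zero.2 ⟨hκ, ?_⟩
    have := h Set.univ
    rw [measure_univ, mul_one] at this
    exact this ▸ measure_ne_top _ _
  have hp1 : (1 : ℝ) < p := by exact_mod_cast (Fact.out : p.Prime).one_lt
  have h4 : (p : ℝ) - 1 ≠ 0 := by linarith
  have hdiff := measureReal_inter_add_sdiff (μ := haarZp3 p) (s := {y : Fin 3 → ℤ_[p] | IsUnit (y 0)})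
    (isCompact_splitSet (p := p)).isClosed.measurableSet
  rw [haarZp3_real_units_inter_splitSet hp, haarZp3_real_units] at hdiff
  rw [proportion, slopeHalf_inter_irreducibleQuartics, slopeHalf_eq_image, measureReal_def,
    measureReal_def, h, h, ENNReal.toReal_mul, ENNReal.toReal_mul, mul_div_mul_left _ _ hκ',
    ← measureReal_def, ← measureReal_def, haarZp3_real_units, eq_sub_of_add_eq' hdiff]
  field_simp
  ring

end PadicQuartic


theorem lemma4p3 (p : ℕ) [Fact p.Prime] (hp : p ≠ 2) :
    (∀ c : Fin 3 → ℤ_[p], c ∈ PadicQuartic.slopeHalf p ↔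
      PadicQuartic.newtonPolygon (PadicQuartic.quartic c) =
        segment ℝ ((0, 2) : ℝ × ℝ) ((4, 0) : ℝ × ℝ)) ∧
    MeasurableSet (PadicQuartic.slopeHalf p) ∧
    MeasurableSet (PadicQuartic.slopeHalf p ∩ PadicQuartic.irreducibleQuartics p) ∧
    0 < PadicQuartic.haarZp3 p (PadicQuartic.slopeHalf p) ∧
    PadicQuartic.proportion p (PadicQuartic.irreducibleQuartics p) (PadicQuartic.slopeHalf p) =
      ((p : ℝ) ^ 2 + 3 * p + 1) / (2 * p * (p + 1)) ∧
    PadicQuartic.proportion p (PadicQuartic.irreducibleQuartics p) (PadicQuartic.slopeHalf p) =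
      ((p : ℝ) + 2) / (2 * (p + 1)) + 1 / (2 * p) := by
  refine ⟨fun c => ⟨PadicQuartic.newtonPolygon_eq_segment_of_mem,
    PadicQuartic.mem_slopeHalf_of_newtonPolygon⟩, PadicQuartic.measurableSet_slopeHalf,
    PadicQuartic.measurableSet_slopeHalf_inter_irreducibleQuartics,
    PadicQuartic.haarZp3_slopeHalf_pos, PadicQuartic.proportion_irreducibleQuartics hp, ?_⟩
  rw [PadicQuartic.proportion_irreducibleQuartics hp]
  have hp0 : (0 : ℝ) < p := by exact_mod_cast (Fact.out : p.Prime).pos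
  field_simp
  ring
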